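/- Let $N=2^n$ with $n\ge 0$. For an image $X\in\mathbb{C}^{N\times N}$ let $$\|X\|_{TV}=\sum_{j=1}^{N-1}\sum_{k=1}^{N}|X_{j+1,k}-X_{j,k}|+\sum_{j=1}^{N}\sum_{k=1}^{N-1}|X_{j,k+1}-X_{j,k}|$$ be its (anisotropic) total variation. Let $H^0=\mathbf 1_{[0,1)}$, $H^1=\mathbf 1_{[0,1/2)}-\mathbf 1_{[1/2,1)}$, $H^e(u,v)=H^{e_1}(u)H^{e_2}(v)$, and $H^e_{j,k}(x)=2^jH^e(2^jx-k)$ for $e\in\{(0,1),(1,0),(1,1)\}$, $0\le j\le n-1$ and $k\in\{0,\dots,2^j-1\}^2$. Each $H^e_{j,k}$ is constant on the cells $[\frac{a-1}{N},\frac aN)\times[\frac{b-1}{N},\frac bN)$, $1\le a,b\le N$. Let $h^e_{j,k}\in\mathbb{C}^{N\times N}$ be the image whose pixel $(a,b)$ is $\frac1N$ times the value of $H^e_{j,k}$ on that cell, and let $h^0$ be the constant image with all pixels equal to $\frac1N$. These $N^2$ images form the discrete bivariate Haar basis of $\mathbb{C}^{N\times N}$. With $\langle X,M\rangle=\operatorname{trace}(XM^*)$,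 let $c_{(k)}(X)$, $k\ge1$, denote the Haar coefficients $\langle X,h^e_{j,k}\rangle$ (the constant image $h^0$ excluded), arranged in order of decreasing magnitude, and let $\bar c_{(k)}(X)$ denote all $N^2$ coefficients, including $\langle X,h^0\rangle$, arranged in the same way; both are set to $0$ when $k$ exceeds the number of coefficients. Proposition. There is an absolute constant $C>0$ such that for every $n\ge 0$, every $X\in\mathbb{C}^{N\times N}$ with $N=2^n$, and every $k\ge 1$, $$|c_{(k)}(X)|\le C\,\frac{\|X\|_{TV}}{k}.$$ Moreover, $|\bar c_{(k)}(X)|\le C\,\|X\|_{TV}/k$ for every $k\ge2$, and also for $k=1$ if $X$ has mean zero, i.e. $\sum_{a,b}X_{a,b}=0$. -/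

import Mathlib

namespace HaarTV

noncomputable section

/-! ### Discrete images and total variation

Pixels of an `N × N` image are indexed from `0` to `N - 1`. -/

/-- Discrete derivative in the first index, set to zero in the last row. -/
def gradX {N : ℕ} (X : Matrix (Fin N) (Fin N) ℂ) (a b : Fin N) : ℂ :=
  if h : (a : ℕ) + 1 < N then X ⟨(a : ℕ) + 1, h⟩ b - X a b else 0

/-- Discrete derivative in the second index, set to zero in the last column. -/
def gradY {N : ℕ} (X : Matrix (Fin N) (Fin N) ℂ) (a b : Fin N) : ℂ :=
  if h : (b : ℕ) + 1 < N then X a ⟨(b : ℕ) + 1, h⟩ - X a b else 0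

/-- The (anisotropic) total variation: the `ℓ¹` norm of the discrete gradient. -/
def totalVariation {N : ℕ} (X : Matrix (Fin N) (Fin N) ℂ) : ℝ :=
  ∑ a, ∑ b, (‖gradX X a b‖ + ‖gradY X a b‖)

/-! ### The bivariate Haar system on the unit square -/

/-- The univariate constant function `H⁰ = 1_{[0,1)}`. -/
def haarZero (t : ℝ) : ℝ := if 0 ≤ t ∧ t < 1 then 1 else 0

/-- The univariate mother wavelet `H¹ = 1_{[0,1/2)} - 1_{[1/2,1)}`. -/
def haarOne (t : ℝ) : ℝ :=
  if 0 ≤ t ∧ t < 1 / 2 then 1 else if 1 / 2 ≤ t ∧ t < 1 then -1 else 0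

/-- `H⁰` or `H¹`. -/
def haarUni (ε : Fin 2) : ℝ → ℝ := if ε = 0 then haarZero else haarOne

/-- `H^e(u,v) = H^{e₁}(u) H^{e₂}(v)`. -/
def haarTensor (e : Fin 2 × Fin 2) (x : ℝ × ℝ) : ℝ :=
  haarUni e.1 x.1 * haarUni e.2 x.2

/-- `H^e_{j,k}(x) = 2^j H^e(2^j x - k)`. -/
def haarFun (j : ℕ) (k : ℕ × ℕ) (e : Fin 2 × Fin 2) (x : ℝ × ℝ) : ℝ :=
  2 ^ j * haarTensor e (2 ^ j * x.1 - k.1, 2 ^ j * x.2 - k.2)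

/-! ### The discrete Haar system on `2^n × 2^n` images -/

/-- The indices `(j, k, e)` of the `4^n - 1` bivariate Haar wavelets with `0 ≤ j ≤ n - 1`,
`k ∈ ℤ² ∩ 2^j [0,1)²` and `e ∈ {(0,1), (1,0), (1,1)}`. -/
abbrev HaarIndex (n : ℕ) : Type :=
  (j : Fin n) × ((Fin (2 ^ (j : ℕ)) × Fin (2 ^ (j : ℕ))) × {e : Fin 2 × Fin 2 // e ≠ (0, 0)})

/-- The Haar wavelet with a given index, as a function on the plane. -/
def haarWavelet {n : ℕ} (i : HaarIndex n) : ℝ × ℝ → ℝ :=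
  haarFun i.1 ((i.2.1.1 : ℕ), (i.2.1.2 : ℕ)) i.2.2.1

/-- The `N × N` image of a function `f` which is constant on each of the cells
`[a/N, (a+1)/N) × [b/N, (b+1)/N)`: its pixel `(a, b)` is `1/N` times the value of `f` there
(this normalization makes the identification of images with functions isometric). -/
def toImage (N : ℕ) (f : ℝ × ℝ → ℝ) : Matrix (Fin N) (Fin N) ℂ :=
  fun a b => ((f ((a : ℝ) / N, (b : ℝ) / N) / N : ℝ) : ℂ)

/-- The discrete Haar wavelet `h^e_{j,k}`. -/
def haarImage {n : ℕ} (i : HaarIndex n) : Matrix (Fin (2 ^ n)) (Fin (2 ^ n)) ℂ :=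
  toImage (2 ^ n) (haarWavelet i)

/-- The discrete image of the constant function `1` on the unit square. -/
def constImage (n : ℕ) : Matrix (Fin (2 ^ n)) (Fin (2 ^ n)) ℂ :=
  toImage (2 ^ n) (haarTensor (0, 0))

/-- `⟨X, M⟩ = trace (X M*)`. -/
def imageInner {N : ℕ} (X M : Matrix (Fin N) (Fin N) ℂ) : ℂ :=
  (X * M.conjTranspose).trace

/-- The bivariate Haar coefficients `⟨X, h^e_{j,k}⟩`, indexed by `(j, k, e)`. -/
def haarCoeff {n : ℕ} (X : Matrix (Fin (2 ^ n)) (Fin (2 ^ n)) ℂ) (i : HaarIndex n) : ℂ :=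
  imageInner X (haarImage i)

/-- All `4^n` coefficients of `X` in the discrete Haar basis: the wavelet coefficients together
with the coefficient of the constant image (index `none`). -/
def fullHaarCoeff {n : ℕ} (X : Matrix (Fin (2 ^ n)) (Fin (2 ^ n)) ℂ) :
    Option (HaarIndex n) → ℂ
  | none => imageInner X (constImage n)
  | some i => haarCoeff X i

/-- The `k`-th largest magnitude (`k = 1, 2, …`) of a finite family of complex numbers, counted
with multiplicity: entry `k` of the list of magnitudes in decreasing order, and `0` if the family
has fewer than `k` members. -/
def kthLargest {ι : Type*} [Fintype ι] (c : ι → ℂ) (k : ℕ) : ℝ :=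
  (((Finset.univ : Finset ι).val.map fun i => ‖c i‖).sort (· ≥ ·)).getD (k - 1) 0

end

end HaarTV

/-! The weak-type bound follows from a single summability estimate: the sum of `gauge` |c| over all
wavelet coefficients is at most a constant times the total variation. Applied to X/t, it counts the
coefficients with |c| ≥ t. Growth of `gauge` like √x at infinity matters: linear growth would amount
to an ℓ¹ bound, which fails.

For a dyadic square Q let V(Q) be the variation inside Q, g(Q) the normalized oscillation of the
sums over its four children (it dominates the three Haar coefficients of Q), and s(Q) = V(Q) - V(m),
with m the child of largest variation. Remove from the 4 × 4 grid of grandchildren the heaviest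
child of m. The other fifteen squares stay connected, so their sums agree up to a multiple of V(Q)
minus the variation of the removed square, which is s(Q) + s(m). The exceptional sum enters g(Q)
with half the weight it has in g(m), hence g(Q) ≤ g(m)/2 + 108 (s(Q) + s(m))
(`cellOsc_succ_succ_le`).

Through `gauge` the factor 1/2 becomes a contraction by 3/4 (`gauge_le_of_le_half_add`), so the sum
of `gauge` g is controlled by that of `gauge` s. The latter is paid for by `potential`, which is
superadditive, at most 2x, and loses at least `gauge` s / 16 whenever a square is split
(`potential_split`). Both effects are combined in `treePotential`, whose decrease telescopes over
the scales (`sum_gauge_cellOsc_le`). -/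

namespace HaarTV

/-! ### A gauge function and a superadditive potential -/

/-- The gauge `x² / (q (q + 1)²)`, where `q = √(1 + x)`: it behaves like `x²` near `0` and like
`√x` near infinity. -/
noncomputable def gauge (x : ℝ) : ℝ := x ^ 2 / (√(1 + x) * (√(1 + x) + 1) ^ 2)

/-- The superadditive potential `2x - 2(√(1 + x) - 1)`. -/
noncomputable def potential (x : ℝ) : ℝ := 2 * x - 2 * (√(1 + x) - 1)

lemma one_le_sqrt_one_add {x : ℝ} (hx : 0 ≤ x) : 1 ≤ √(1 + x) :=
  Real.one_le_sqrt.2 (by linarith)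

lemma sq_sqrt_one_add {x : ℝ} (hx : 0 ≤ x) : √(1 + x) ^ 2 = 1 + x :=
  Real.sq_sqrt (by linarith)

lemma gauge_nonneg {x : ℝ} : 0 ≤ gauge x := by
  unfold gauge; positivity

@[simp] lemma gauge_zero : gauge 0 = 0 := by simp [gauge]

@[simp] lemma potential_zero : potential 0 = 0 := by simp [potential]

lemma gauge_eq {x : ℝ} (hx : 0 ≤ x) : gauge x = (√(1 + x) - 1) ^ 2 / √(1 + x) := by
  have h1 := one_le_sqrt_one_add hx
  have h2 := sq_sqrt_one_add hx
  unfold gauge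
  set q := √(1 + x)
  have hxq : x = (q - 1) * (q + 1) := by linarith [h2]
  rw [hxq, mul_pow, div_eq_div_iff (by positivity) (by positivity)]
  ring

/-- In terms of q = √(1 + x) the gauge is q - 2 + 1/q, which increases for q ≥ 1. -/
lemma gauge_mono {x y : ℝ} (hx : 0 ≤ x) (hxy : x ≤ y) : gauge x ≤ gauge y := by
  rw [gauge_eq hx, gauge_eq (hx.trans hxy)]
  have h1 := one_le_sqrt_one_add hx
  have h2 : √(1 + x) ≤ √(1 + y) := Real.sqrt_le_sqrt (by linarith)
  set p := √(1 + x)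
  set q := √(1 + y)
  rw [div_le_div_iff₀ (by linarith) (by linarith)]
  have : 0 ≤ (q - p) * (p * q - 1) := mul_nonneg (by linarith) (by nlinarith)
  nlinarith

lemma gauge_mul_le {c x : ℝ} (hc : 1 ≤ c) (hx : 0 ≤ x) : gauge (c * x) ≤ c ^ 2 * gauge x := by
  unfold gauge
  rw [mul_pow, mul_div_assoc]
  have h : √(1 + x) ≤ √(1 + c * x) := Real.sqrt_le_sqrt (by nlinarith)
  have h1 := one_le_sqrt_one_add hx
  gcongr

/-- Each factor √ in the denominator shrinks by at most 3/4, and (9/16)² / (3/4)³ = 3/4. -/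
lemma gauge_contract {x : ℝ} (hx : 0 ≤ x) : gauge (9 / 16 * x) ≤ 3 / 4 * gauge x := by
  unfold gauge
  have h1 := one_le_sqrt_one_add hx
  have h : 3 / 4 * √(1 + x) ≤ √(1 + 9 / 16 * x) := by
    apply Real.le_sqrt_of_sq_le
    rw [mul_pow, sq_sqrt_one_add hx]; linarith
  set q := √(1 + x)
  set r := √(1 + 9 / 16 * x)
  have h2 : 3 / 4 * (q + 1) ≤ r + 1 := by linarith
  calc (9 / 16 * x) ^ 2 / (r * (r + 1) ^ 2)
      ≤ (9 / 16 * x) ^ 2 / ((3 / 4 * q) * (3 / 4 * (q + 1)) ^ 2) := by gcongr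
    _ = 3 / 4 * (x ^ 2 / (q * (q + 1) ^ 2)) := by
      field_simp
      ring

lemma gauge_add_le {x y : ℝ} (hx : 0 ≤ x) (hy : 0 ≤ y) :
    gauge (x + y) ≤ 4 * gauge x + 4 * gauge y := by
  have hx' := gauge_nonneg (x := x)
  have hy' := gauge_nonneg (x := y)
  rcases le_total x y with h | h
  · have h1 := gauge_mono (add_nonneg hx hy) (show x + y ≤ 2 * y by linarith)
    have h2 := gauge_mul_le (c := 2) (by norm_num) hy
    linarith
  · have h1 := gauge_mono (add_nonneg hx hy) (show x + y ≤ 2 * x by linarith)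
    have h2 := gauge_mul_le (c := 2) (by norm_num) hx
    linarith

lemma gauge_le_of_le_half_add {x y z : ℝ} (hx : 0 ≤ x) (hy : 0 ≤ y) (hz : 0 ≤ z)
    (h : x ≤ y / 2 + z) : gauge x ≤ 3 / 4 * gauge y + 81 * gauge z := by
  have hy' := gauge_nonneg (x := y)
  have hz' := gauge_nonneg (x := z)
  -- The threshold 1/16 gives 1/2 + 1/16 = 9/16 in the first case; in the second, y < 16z yields x ≤
  -- 9z and 81 = 9².
  rcases le_total z (y / 16) with hc | hc
  · have h1 := gauge_mono hx (show x ≤ 9 / 16 * y by linarith)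
    have h2 := gauge_contract hy
    linarith
  · have h1 := gauge_mono hx (show x ≤ 9 * z by linarith)
    have h2 := gauge_mul_le (c := 9) (by norm_num) hz
    linarith

lemma sqrt_le_half {x : ℝ} (hx : 0 ≤ x) : √(1 + x) - 1 ≤ x / 2 := by
  have := Real.sqrt_one_add_le (x := x) (by linarith)
  linarith

lemma gauge_le_potential {x : ℝ} (hx : 0 ≤ x) : gauge x ≤ potential x := by
  have h1 := one_le_sqrt_one_add hx
  have h2 := sqrt_le_half hx
  have h3 : gauge x ≤ √(1 + x) - 1 := by
    rw [gauge_eq hx, div_le_iff₀ (by linarith)]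
    nlinarith
  unfold potential
  linarith

lemma potential_nonneg {x : ℝ} (hx : 0 ≤ x) : 0 ≤ potential x :=
  gauge_nonneg.trans (gauge_le_potential hx)

lemma potential_le {x : ℝ} (hx : 0 ≤ x) : potential x ≤ 2 * x := by
  have h1 := one_le_sqrt_one_add hx
  unfold potential
  linarith

/-- The function √(1 + x) - 1 is concave and vanishes at 0, hence is subadditive. -/
lemma potential_superadd {x y : ℝ} (hx : 0 ≤ x) (hy : 0 ≤ y) :
    potential x + potential y ≤ potential (x + y) := by
  have hp := one_le_sqrt_one_add hx
  have hq := one_le_sqrt_one_add hy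
  have hp2 := sq_sqrt_one_add hx
  have hq2 := sq_sqrt_one_add hy
  have h : √(1 + (x + y)) ≤ √(1 + x) + √(1 + y) - 1 := by
    apply Real.sqrt_le_iff.2 ⟨by linarith, ?_⟩
    nlinarith [mul_nonneg (sub_nonneg.2 hp) (sub_nonneg.2 hq)]
  unfold potential
  linarith

/-- With p, q the two roots, (p + q - 1)² exceeds 1 + x + y by 2(p - 1)(q - 1). This slack allows
half the gauge, d = (q - 1)²/(2q), to be subtracted from p + q - 1. -/
lemma potential_superadd_gauge {x y : ℝ} (hy : 0 ≤ y) (hyx : y ≤ x) :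
    potential x + potential y + gauge y ≤ potential (x + y) := by
  have hx := hy.trans hyx
  have hp := one_le_sqrt_one_add hx
  have hq := one_le_sqrt_one_add hy
  have hp2 := sq_sqrt_one_add hx
  have hq2 := sq_sqrt_one_add hy
  have hqp : √(1 + y) ≤ √(1 + x) := Real.sqrt_le_sqrt (by linarith)
  rw [gauge_eq hy]
  unfold potential
  set p := √(1 + x)
  set q := √(1 + y)
  have hd : (q - 1) ^ 2 / (2 * q) ≤ q - 1 := by
    rw [div_le_iff₀ (by linarith)]
    nlinarith
  have h : √(1 + (x + y)) ≤ p + q - 1 - (q - 1) ^ 2 / (2 * q) := by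
    apply Real.sqrt_le_iff.2 ⟨by linarith, ?_⟩
    set d := (q - 1) ^ 2 / (2 * q) with hd'
    have hdq : d * (2 * q) = (q - 1) ^ 2 := by rw [hd']; field_simp
    have hd0 : 0 ≤ d := by positivity
    have key : d * (p + q - 1) ≤ (p - 1) * (q - 1) := by
      have e : d * (p + q - 1) * (2 * q) = (q - 1) ^ 2 * (p + q - 1) := by
        rw [← hdq]; ring
      have : d * (p + q - 1) * (2 * q) ≤ (p - 1) * (q - 1) * (2 * q) := by
        rw [e]
        have : (q - 1) * (p + q - 1) ≤ (p - 1) * (2 * q) := by nlinarith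
        nlinarith
      exact le_of_mul_le_mul_right this (by linarith)
    nlinarith [sq_nonneg d]
  have e : (q - 1) ^ 2 / q = 2 * ((q - 1) ^ 2 / (2 * q)) := by field_simp
  linarith

/-- Splitting a total `v` into a largest part `a` and three further parts, with a nonnegative
remainder, decreases the total potential by an amount controlled by the gauge of `v - a`. -/
lemma potential_split {v a b c d : ℝ} (hb : 0 ≤ b) (hc : 0 ≤ c) (hd : 0 ≤ d)
    (hba : b ≤ a) (hca : c ≤ a) (hda : d ≤ a) (hv : a + b + c + d ≤ v) :
    potential a + potential b + potential c + potential d + gauge (v - a) / 16 ≤ potential v := by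
  have ha := hb.trans hba
  obtain ⟨l, hl, rfl⟩ : ∃ l, 0 ≤ l ∧ v = a + b + c + d + l := ⟨v - (a + b + c + d), by linarith, by ring⟩
  -- If z is the largest of b, c, d, l, then v - a ≤ 4z, and 4² = 16.
  have scale : ∀ z, 0 ≤ z → b ≤ z → c ≤ z → d ≤ z → l ≤ z →
      gauge (a + b + c + d + l - a) / 16 ≤ gauge z := by
    intro z hz h1 h2 h3 h4
    have e1 := gauge_mono (x := a + b + c + d + l - a) (y := 4 * z) (by linarith) (by linarith)
    have e2 := gauge_mul_le (c := 4) (by norm_num) hz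
    linarith
  have four : ∀ {x y z w : ℝ}, 0 ≤ x → 0 ≤ y → 0 ≤ z → 0 ≤ w →
      potential x + potential y + potential z + potential w ≤ potential (x + y + z + w) := by
    intro x y z w hx hy hz hw
    have e1 := potential_superadd hx hy
    have e2 := potential_superadd (add_nonneg hx hy) hz
    have e3 := potential_superadd (add_nonneg (add_nonneg hx hy) hz) hw
    linarith
  have hlp := potential_nonneg hl
  have branch : ∀ x y z : ℝ, 0 ≤ x → 0 ≤ y → 0 ≤ z → x ≤ a →
      potential a + potential x + potential y + potential z + gauge x ≤
        potential (a + x + y + z + l) := by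
    intro x y z hx hy hz hxa
    have e1 := potential_superadd_gauge hx hxa
    have e2 := four (add_nonneg ha hx) hy hz hl
    linarith
  -- The remainder l may exceed a, so quantitative superadditivity is unavailable; the whole
  -- potential of l, which dominates its gauge, is spare instead.
  by_cases hL : b ≤ l ∧ c ≤ l ∧ d ≤ l
  · have e1 := scale l hl hL.1 hL.2.1 hL.2.2 le_rfl
    have e2 := four ha hb hc hd
    have e3 := potential_superadd (add_nonneg (add_nonneg (add_nonneg ha hb) hc) hd) hl
    have e4 := gauge_le_potential hl
    linarith
  rcases le_total b c with h1 | h1 <;> rcases le_total c d with h2 | h2 <;>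
    rcases le_total b d with h3 | h3
  all_goals
    first
    | (have hm : b ≤ d ∧ c ≤ d := ⟨by linarith, by linarith⟩
       have hld : l ≤ d := by
         by_contra hcon
         exact hL ⟨by linarith, by linarith, by linarith⟩
       have e1 := scale d hd hm.1 hm.2 le_rfl hld
       have e2 := branch d b c hd hb hc hda
       rw [show a + d + b + c + l = a + b + c + d + l by ring] at e2
       linarith)
    | (have hm : b ≤ c ∧ d ≤ c := ⟨by linarith, by linarith⟩
       have hld : l ≤ c := by
         by_contra hcon
         exact hL ⟨by linarith, by linarith, by linarith⟩
       have e1 := scale c hc hm.1 le_rfl hm.2 hld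
       have e2 := branch c b d hc hb hd hca
       rw [show a + c + b + d + l = a + b + c + d + l by ring] at e2
       linarith)
    | (have hm : c ≤ b ∧ d ≤ b := ⟨by linarith, by linarith⟩
       have hld : l ≤ b := by
         by_contra hcon
         exact hL ⟨by linarith, by linarith, by linarith⟩
       have e1 := scale b hb le_rfl hm.1 hm.2 hld
       have e2 := branch b c d hb hc hd hba
       linarith)

/-- The constant `4 * 81 * 108 ^ 2` of the one-step estimate. -/
noncomputable def stepConst : ℝ := 4 * 81 * 108 ^ 2

/-- The quantity that decreases along the dyadic tree, as a function of the variation `v`, the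
oscillation `g` and the variation defect `s` of a square. -/
noncomputable def treePotential (v g s : ℝ) : ℝ :=
  128 * stepConst * potential v - 3 * gauge g - 4 * stepConst * gauge s

lemma potential_split_children {V : ℝ} {v : Fin 2 × Fin 2 → ℝ} {m : Fin 2 × Fin 2}
    (hv : ∀ i, 0 ≤ v i) (hm : ∀ i, v i ≤ v m) (hV : ∑ i, v i ≤ V) :
    ∑ i, potential (v i) + gauge (V - v m) / 16 ≤ potential V := by
  simp only [Fintype.sum_prod_type, Fin.sum_univ_two] at hV ⊢
  have split := fun b c d : Fin 2 × Fin 2 => potential_split (v := V) (hv b) (hv c) (hv d)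
    (hm b) (hm c) (hm d)
  obtain ⟨i, j⟩ := m
  fin_cases i <;> fin_cases j <;> simp only [Fin.zero_eta, Fin.mk_one, Fin.isValue] at *
  · linarith [split (0, 1) (1, 0) (1, 1) (by linarith)]
  · linarith [split (0, 0) (1, 0) (1, 1) (by linarith)]
  · linarith [split (0, 0) (0, 1) (1, 1) (by linarith)]
  · linarith [split (0, 0) (0, 1) (1, 0) (by linarith)]

/-- The weight 128 turns the gain `gauge s / 16` into `8 * stepConst * gauge s`: half compensates
the negative term of the parent, half pays the s-term in four times `h4`. The remaining terms of
`h4` are paid by the negative terms of the child m. -/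
lemma treePotential_step {V g s : ℝ} {v g' s' : Fin 2 × Fin 2 → ℝ} {m : Fin 2 × Fin 2}
    (hv : ∀ i, 0 ≤ v i) (hg' : ∀ i, 0 ≤ g' i) (hs' : ∀ i, 0 ≤ s' i) (hg : 0 ≤ g) (hs : 0 ≤ s)
    (hm : ∀ i, v i ≤ v m) (hV : ∑ i, v i ≤ V) (hsV : s = V - v m)
    (h : g ≤ g' m / 2 + 108 * (s + s' m)) :
    gauge g + ∑ i, treePotential (v i) (g' i) (s' i) ≤ treePotential V g s := by
  have hsplit := potential_split_children hv hm hV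
  rw [← hsV] at hsplit
  have h1 := gauge_le_of_le_half_add hg (hg' m) (z := 108 * (s + s' m))
    (mul_nonneg (by norm_num) (add_nonneg hs (hs' m))) h
  have h2 := gauge_mul_le (c := 108) (by norm_num) (add_nonneg hs (hs' m))
  have h3 := gauge_add_le hs (hs' m)
  have h4 : gauge g ≤ 3 / 4 * gauge (g' m) + stepConst * gauge s + stepConst * gauge (s' m) := by
    unfold stepConst; linarith
  have h5 : ∑ i, treePotential (v i) (g' i) (s' i) ≤
      128 * stepConst * ∑ i, potential (v i) - 3 * gauge (g' m) - 4 * stepConst * gauge (s' m) := by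
    have e1 : gauge (g' m) ≤ ∑ i, gauge (g' i) :=
      Finset.single_le_sum (f := fun i => gauge (g' i)) (fun i _ => gauge_nonneg) (Finset.mem_univ m)
    have e2 : gauge (s' m) ≤ ∑ i, gauge (s' i) :=
      Finset.single_le_sum (f := fun i => gauge (s' i)) (fun i _ => gauge_nonneg) (Finset.mem_univ m)
    simp only [treePotential, Finset.sum_sub_distrib, ← Finset.mul_sum]
    have : 0 < stepConst := by unfold stepConst; norm_num
    nlinarith
  have h6 : 128 * stepConst * (∑ i, potential (v i) + gauge s / 16) ≤
      128 * stepConst * potential V :=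
    mul_le_mul_of_nonneg_left hsplit (by unfold stepConst; norm_num)
  have h7 : treePotential V g s =
      128 * stepConst * potential V - 3 * gauge g - 4 * stepConst * gauge s := rfl
  linarith

/-! ### Dyadic squares: sums and variations -/

/-- Sum of the values of `f` over the square `[pL, (p+1)L) × [qL, (q+1)L)`. -/
def cellSum (f : ℕ → ℕ → ℂ) (L p q : ℕ) : ℂ :=
  ∑ u ∈ Finset.Ico (p * L) ((p + 1) * L), ∑ v ∈ Finset.Ico (q * L) ((q + 1) * L), f u v

/-- The edges in the first direction having both endpoints in the rectangle
`[a, b) × [c, d)`, given by their lower endpoints. -/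
def edgeSet (a b c d : ℕ) : Finset (ℕ × ℕ) := Finset.Ico a (b - 1) ×ˢ Finset.Ico c d

/-- Variation of `f` in the first direction along the edges inside the square
`[pL, (p+1)L) × [qL, (q+1)L)`. -/
noncomputable def horizVar (f : ℕ → ℕ → ℂ) (L p q : ℕ) : ℝ :=
  ∑ x ∈ edgeSet (p * L) ((p + 1) * L) (q * L) ((q + 1) * L), ‖f (x.1 + 1) x.2 - f x.1 x.2‖

/-- Variation of `f` along the edges inside the square `[pL, (p+1)L) × [qL, (q+1)L)`. -/
noncomputable def cellVar (f : ℕ → ℕ → ℂ) (L p q : ℕ) : ℝ :=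
  horizVar f L p q + horizVar (fun u v => f v u) L q p

lemma horizVar_nonneg (f : ℕ → ℕ → ℂ) (L p q : ℕ) : 0 ≤ horizVar f L p q :=
  Finset.sum_nonneg fun _ _ => norm_nonneg _

lemma cellVar_nonneg (f : ℕ → ℕ → ℂ) (L p q : ℕ) : 0 ≤ cellVar f L p q :=
  add_nonneg (horizVar_nonneg ..) (horizVar_nonneg ..)

lemma cellVar_swap (f : ℕ → ℕ → ℂ) (L p q : ℕ) :
    cellVar (fun u v => f v u) L q p = cellVar f L p q := by
  unfold cellVar; rw [add_comm]

lemma cellSum_swap (f : ℕ → ℕ → ℂ) (L p q : ℕ) :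
    cellSum (fun u v => f v u) L q p = cellSum f L p q :=
  Finset.sum_comm

lemma mem_edgeSet {a b c d : ℕ} {x : ℕ × ℕ} :
    x ∈ edgeSet a b c d ↔ (a ≤ x.1 ∧ x.1 + 1 < b) ∧ c ≤ x.2 ∧ x.2 < d := by
  simp only [edgeSet, Finset.mem_product, Finset.mem_Ico]
  omega

lemma sum_Ico_two_mul {M : Type*} [AddCommMonoid M] (F : ℕ → M) (L p : ℕ) :
    ∑ u ∈ Finset.Ico (p * (2 * L)) ((p + 1) * (2 * L)), F u =
      ∑ i : Fin 2, ∑ u ∈ Finset.Ico ((2 * p + i) * L) ((2 * p + i + 1) * L), F u := by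
  rw [Fin.sum_univ_two, ← Finset.sum_Ico_consecutive F (n := (2 * p + 1) * L)]
  · congr 2 <;> simp <;> congr 1 <;> ring
  · nlinarith
  · nlinarith

lemma cellSum_two_mul (f : ℕ → ℕ → ℂ) (L p q : ℕ) :
    cellSum f (2 * L) p q =
      ∑ i : Fin 2 × Fin 2, cellSum f L (2 * p + i.1) (2 * q + i.2) := by
  unfold cellSum
  rw [sum_Ico_two_mul, Fintype.sum_prod_type]
  refine Finset.sum_congr rfl fun i _ => ?_
  rw [Finset.sum_comm]
  rw [sum_Ico_two_mul]
  refine Finset.sum_congr rfl fun j _ => ?_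
  rw [Finset.sum_comm]

lemma edgeSet_disjoint {L p q p' q' : ℕ} (h : (p, q) ≠ (p', q')) :
    Disjoint (edgeSet (p * L) ((p + 1) * L) (q * L) ((q + 1) * L))
      (edgeSet (p' * L) ((p' + 1) * L) (q' * L) ((q' + 1) * L)) := by
  rw [Finset.disjoint_left]
  rintro x hx hx'
  rw [mem_edgeSet] at hx hx'
  apply h
  have key : ∀ {a b y : ℕ}, a * L ≤ y → y < (a + 1) * L → b * L ≤ y → y < (b + 1) * L → a = b := by
    intro a b y h1 h2 h3 h4
    have e1 := lt_of_mul_lt_mul_right (h1.trans_lt h4) (Nat.zero_le L)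
    have e2 := lt_of_mul_lt_mul_right (h3.trans_lt h2) (Nat.zero_le L)
    omega
  have e1 : p = p' := key hx.1.1 (by omega) hx'.1.1 (by omega)
  have e2 : q = q' := key hx.2.1 hx.2.2 hx'.2.1 hx'.2.2
  rw [e1, e2]

lemma edgeSet_mono {a b c d a' b' c' d' : ℕ} (ha : a' ≤ a) (hb : b ≤ b') (hc : c' ≤ c)
    (hd : d ≤ d') : edgeSet a b c d ⊆ edgeSet a' b' c' d' := by
  intro x hx
  rw [mem_edgeSet] at hx ⊢
  omega

/-- Distinct squares of side L share no inner edge; edges crossing between squares are simply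
dropped. -/
lemma sum_horizVar_le {ι : Type*} [Fintype ι] (f : ℕ → ℕ → ℂ) (L m p q : ℕ) (P Q : ι → ℕ)
    (hinj : ∀ i j, i ≠ j → (P i, Q i) ≠ (P j, Q j))
    (hP : ∀ i, p * m ≤ P i ∧ P i < (p + 1) * m) (hQ : ∀ i, q * m ≤ Q i ∧ Q i < (q + 1) * m) :
    ∑ i, horizVar f L (P i) (Q i) ≤ horizVar f (m * L) p q := by
  classical
  unfold horizVar
  rw [← Finset.sum_biUnion (fun i _ j _ hij => edgeSet_disjoint (hinj i j hij))]
  refine Finset.sum_le_sum_of_subset_of_nonneg ?_ fun _ _ _ => norm_nonneg _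
  refine Finset.biUnion_subset.2 fun i _ => edgeSet_mono ?_ ?_ ?_ ?_
  · rw [← mul_assoc]; exact Nat.mul_le_mul_right _ (hP i).1
  · rw [← mul_assoc]; exact Nat.mul_le_mul_right _ (hP i).2
  · rw [← mul_assoc]; exact Nat.mul_le_mul_right _ (hQ i).1
  · rw [← mul_assoc]; exact Nat.mul_le_mul_right _ (hQ i).2

lemma sum_cellVar_le (f : ℕ → ℕ → ℂ) (L p q : ℕ) :
    ∑ i : Fin 2 × Fin 2, cellVar f L (2 * p + i.1) (2 * q + i.2) ≤ cellVar f (2 * L) p q := by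
  unfold cellVar
  rw [Finset.sum_add_distrib]
  refine add_le_add (sum_horizVar_le f L 2 p q _ _ ?_ ?_ ?_)
    (sum_horizVar_le (fun u v => f v u) L 2 q p _ _ ?_ ?_ ?_)
  all_goals
    intro i
    have h1 := i.1.isLt
    have h2 := i.2.isLt
  · rintro j hij h
    rw [Prod.mk.injEq] at h
    exact hij (Prod.ext (Fin.ext (by omega)) (Fin.ext (by omega)))
  · omega
  · omega
  · rintro j hij h
    rw [Prod.mk.injEq] at h
    exact hij (Prod.ext (Fin.ext (by omega)) (Fin.ext (by omega)))
  · omega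
  · omega

/-! ### Poincaré type estimates -/

/-- The sums over two neighbouring squares differ by at most the side length times the variation
inside their union. -/
lemma norm_cellSum_succ_sub_le (f : ℕ → ℕ → ℂ) (L p q : ℕ) :
    ‖cellSum f L (p + 1) q - cellSum f L p q‖ ≤
      L * ∑ x ∈ edgeSet (p * L) ((p + 2) * L) (q * L) ((q + 1) * L),
        ‖f (x.1 + 1) x.2 - f x.1 x.2‖ := by
  -- The second square is the first one shifted by L, so each difference telescopes along a segment
  -- of L edges.
  have h1 : cellSum f L (p + 1) q - cellSum f L p q =
      ∑ u ∈ Finset.Ico (p * L) ((p + 1) * L), ∑ v ∈ Finset.Ico (q * L) ((q + 1) * L),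
        ∑ w ∈ Finset.Ico u (u + L), (f (w + 1) v - f w v) := by
    unfold cellSum
    have e : Finset.Ico ((p + 1) * L) ((p + 1 + 1) * L) =
        (Finset.Ico (p * L) ((p + 1) * L)).map (addRightEmbedding L) := by
      rw [Finset.map_add_right_Ico]
      congr 1 <;> ring
    rw [e, Finset.sum_map, ← Finset.sum_sub_distrib]
    refine Finset.sum_congr rfl fun u _ => ?_
    rw [← Finset.sum_sub_distrib]
    refine Finset.sum_congr rfl fun v _ => ?_
    rw [Finset.sum_Ico_sub (fun w => f w v) (Nat.le_add_right u L)]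
    rfl
  -- For each fixed u the segments for different v are disjoint; the factor L is the number of
  -- values of u.
  have h2 : ∀ u ∈ Finset.Ico (p * L) ((p + 1) * L),
      ‖∑ v ∈ Finset.Ico (q * L) ((q + 1) * L), ∑ w ∈ Finset.Ico u (u + L), (f (w + 1) v - f w v)‖ ≤
      ∑ x ∈ edgeSet (p * L) ((p + 2) * L) (q * L) ((q + 1) * L),
        ‖f (x.1 + 1) x.2 - f x.1 x.2‖ := by
    intro u hu
    rw [Finset.mem_Ico] at hu
    rw [Finset.sum_comm]
    refine (norm_sum_le_of_le _ fun w _ => norm_sum_le _ _).trans ?_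
    rw [← Finset.sum_product' (f := fun w v => ‖f (w + 1) v - f w v‖)]
    refine Finset.sum_le_sum_of_subset_of_nonneg ?_ fun _ _ _ => norm_nonneg _
    have : (p + 2) * L = (p + 1) * L + L := by ring
    exact Finset.product_subset_product_left (Finset.Ico_subset_Ico hu.1 (by omega))
  rw [h1]
  refine (norm_sum_le_of_le _ h2).trans (le_of_eq ?_)
  rw [Finset.sum_const, Nat.card_Ico, nsmul_eq_mul]
  congr 2
  rw [← Nat.sub_mul]
  simp

/-- Sums over neighbouring squares of side `L`, inside a square of side `4L` from which another
square of side `L` has been removed. -/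
lemma norm_cellSum_succ_sub_le_of_ne (f : ℕ → ℕ → ℂ) {L m p q i j P Q : ℕ}
    (hi : i + 1 < m) (hj : j < m) (hP : P < m) (hQ : Q < m)
    (h1 : (i, j) ≠ (P, Q)) (h2 : (i + 1, j) ≠ (P, Q)) :
    ‖cellSum f L (m * p + (i + 1)) (m * q + j) - cellSum f L (m * p + i) (m * q + j)‖ ≤
      L * (cellVar f (m * L) p q - cellVar f L (m * p + P) (m * q + Q)) := by
  refine (norm_cellSum_succ_sub_le f L (m * p + i) (m * q + j)).trans ?_
  refine mul_le_mul_of_nonneg_left ?_ (Nat.cast_nonneg L)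
  have hv : horizVar (fun u v => f v u) L (m * q + Q) (m * p + P) ≤
      horizVar (fun u v => f v u) (m * L) q p := by
    have := sum_horizVar_le (ι := Unit) (fun u v => f v u) L m q p
      (fun _ => m * q + Q) (fun _ => m * p + P) (fun i j h => absurd rfl h)
      (fun _ => ⟨by nlinarith, by nlinarith⟩) (fun _ => ⟨by nlinarith, by nlinarith⟩)
    simpa using this
  -- The edges inside the union of the two neighbours are disjoint from those inside the removed
  -- square.
  have hh : ∑ x ∈ edgeSet ((m * p + i) * L) ((m * p + i + 2) * L) ((m * q + j) * L)
        ((m * q + j + 1) * L), ‖f (x.1 + 1) x.2 - f x.1 x.2‖ +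
      horizVar f L (m * p + P) (m * q + Q) ≤ horizVar f (m * L) p q := by
    unfold horizVar
    rw [← Finset.sum_union]
    · refine Finset.sum_le_sum_of_subset_of_nonneg ?_ fun _ _ _ => norm_nonneg _
      refine Finset.union_subset (edgeSet_mono ?_ ?_ ?_ ?_) (edgeSet_mono ?_ ?_ ?_ ?_)
      all_goals
        rw [← mul_assoc]
        exact Nat.mul_le_mul_right _ (by nlinarith)
    · rw [Finset.disjoint_left]
      rintro x hx hx'
      rw [mem_edgeSet] at hx hx'
      have a1 := lt_of_mul_lt_mul_right (hx.2.1.trans_lt hx'.2.2) (Nat.zero_le L)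
      have a2 := lt_of_mul_lt_mul_right (hx'.2.1.trans_lt hx.2.2) (Nat.zero_le L)
      have a3 := lt_of_mul_lt_mul_right (hx.1.1.trans_lt
        (show x.1 < (m * p + P + 1) * L by omega)) (Nat.zero_le L)
      have a4 := lt_of_mul_lt_mul_right (hx'.1.1.trans_lt
        (show x.1 < (m * p + i + 2) * L by omega)) (Nat.zero_le L)
      have hjQ : j = Q := by omega
      have : i = P ∨ i + 1 = P := by omega
      rcases this with h | h
      · exact h1 (by rw [h, hjQ])
      · exact h2 (by rw [h, hjQ])
  unfold cellVar
  linarith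

lemma norm_sub_le_of_chain {t : ℕ → ℂ} {ρ : ℝ} (hρ : 0 ≤ ρ)
    (h : ∀ i, i + 1 < 4 → ‖t (i + 1) - t i‖ ≤ ρ) {i j : ℕ} (hi : i < 4) (hj : j < 4) :
    ‖t i - t j‖ ≤ 3 * ρ := by
  wlog hij : j ≤ i generalizing i j
  · rw [norm_sub_rev]
    exact this hj hi (by omega)
  rw [← Finset.sum_Ico_sub t hij]
  refine (norm_sum_le_of_le _ fun k hk => h k ?_).trans ?_
  · rw [Finset.mem_Ico] at hk; omega
  · rw [Finset.sum_const, Nat.card_Ico, nsmul_eq_mul]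
    have : ((i - j : ℕ) : ℝ) ≤ 3 := by exact_mod_cast (by omega : i - j ≤ 3)
    gcongr

/-- A function on the `4 × 4` grid with one point removed whose steps are bounded by `ρ` has
oscillation at most `9ρ`. -/
lemma norm_sub_le_of_punctured_grid {s : ℕ → ℕ → ℂ} {ρ : ℝ} (hρ : 0 ≤ ρ) {P Q : ℕ}
    (h₁ : ∀ i j, i + 1 < 4 → j < 4 → (i, j) ≠ (P, Q) → (i + 1, j) ≠ (P, Q) →
      ‖s (i + 1) j - s i j‖ ≤ ρ)
    (h₂ : ∀ i j, i < 4 → j + 1 < 4 → (i, j) ≠ (P, Q) → (i, j + 1) ≠ (P, Q) →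
      ‖s i (j + 1) - s i j‖ ≤ ρ)
    {i j i' j' : ℕ} (hi : i < 4) (hj : j < 4) (hi' : i' < 4) (hj' : j' < 4)
    (h : (i, j) ≠ (P, Q)) (h' : (i', j') ≠ (P, Q)) : ‖s i j - s i' j'‖ ≤ 9 * ρ := by
  have row : ∀ {a b b' : ℕ}, a ≠ P → a < 4 → b < 4 → b' < 4 → ‖s a b - s a b'‖ ≤ 3 * ρ := by
    intro a b b' ha ha4 hb hb'
    refine norm_sub_le_of_chain (t := fun b => s a b) hρ (fun k hk => h₂ a k ha4 hk ?_ ?_) hb hb'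
    all_goals
      simp [ha]
  have col : ∀ {b a a' : ℕ}, b ≠ Q → b < 4 → a < 4 → a' < 4 → ‖s a b - s a' b‖ ≤ 3 * ρ := by
    intro b a a' hb hb4 ha ha'
    refine norm_sub_le_of_chain (t := fun a => s a b) hρ (fun k hk => h₁ k b hk hb4 ?_ ?_) ha ha'
    all_goals
      simp [hb]
  have tri := fun x y z : ℂ => norm_sub_le_norm_sub_add_norm_sub x y z
  simp only [ne_eq, Prod.mk.injEq, not_and_or] at h h'
  -- Rows other than P and columns other than Q avoid the hole. One row and one column suffice
  -- unless both points lie in row P or both in column Q.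
  by_cases c1 : i ≠ P ∧ j' ≠ Q
  · linarith [tri (s i j) (s i j') (s i' j'), row (b := j) (b' := j') c1.1 hi hj hj',
      col (a := i) (a' := i') c1.2 hj' hi hi']
  by_cases c2 : i' ≠ P ∧ j ≠ Q
  · linarith [tri (s i j) (s i' j) (s i' j'), row (b := j) (b' := j') c2.1 hi' hj hj',
      col (a := i) (a' := i') c2.2 hj hi hi']
  -- Both points lie in row P, on either side of the hole or not: detour through another row k,
  -- three lines in all. The other branch is the same for column Q.
  by_cases c3 : i = P
  · obtain ⟨k, hk, hkP⟩ : ∃ k, k < 4 ∧ k ≠ P := by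
      by_cases h0 : P = 0
      · exact ⟨1, by norm_num, by omega⟩
      · exact ⟨0, by norm_num, by omega⟩
    have hjQ : j ≠ Q := by tauto
    have hj'Q : j' ≠ Q := by tauto
    linarith [tri (s i j) (s k j) (s i' j'), tri (s k j) (s k j') (s i' j'),
      row (b := j) (b' := j') hkP hk hj hj', col (a := i) (a' := k) hjQ hj hi hk,
      col (a := k) (a' := i') hj'Q hj' hk hi']
  · obtain ⟨k, hk, hkQ⟩ : ∃ k, k < 4 ∧ k ≠ Q := by
      by_cases h0 : Q = 0
      · exact ⟨1, by norm_num, by omega⟩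
      · exact ⟨0, by norm_num, by omega⟩
    have hi'P : i' ≠ P := by tauto
    linarith [tri (s i j) (s i k) (s i' j'), tri (s i k) (s i' k) (s i' j'),
      col (a := i) (a' := i') hkQ hk hi hi', row (b := j) (b' := k) c3 hi hj hk,
      row (b := k) (b' := j') hi'P hi' hk hj']

/-! ### Oscillation over the four children of a dyadic square -/

/-- Sum of all differences (over ordered pairs) of four complex numbers. -/
noncomputable def pairOsc (x : Fin 2 × Fin 2 → ℂ) : ℝ := ∑ i, ∑ j, ‖x i - x j‖

lemma pairOsc_nonneg (x : Fin 2 × Fin 2 → ℂ) : 0 ≤ pairOsc x :=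
  Finset.sum_nonneg fun _ _ => Finset.sum_nonneg fun _ _ => norm_nonneg _

/-- Each index occurs in 6 of the 12 ordered pairs of distinct indices. -/
lemma pairOsc_le (x : Fin 2 × Fin 2 → ℂ) (c : ℂ) : pairOsc x ≤ 6 * ∑ i, ‖x i - c‖ := by
  have tri : ∀ i j, ‖x i - x j‖ ≤ ‖x i - c‖ + ‖x j - c‖ := fun i j => by
    rw [norm_sub_rev (x j)]
    exact norm_sub_le_norm_sub_add_norm_sub _ _ _
  simp only [pairOsc, Fintype.sum_prod_type, Fin.sum_univ_two, sub_self, norm_zero]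
  linarith [tri (0, 0) (0, 1), tri (0, 0) (1, 0), tri (0, 0) (1, 1), tri (0, 1) (0, 0),
    tri (0, 1) (1, 0), tri (0, 1) (1, 1), tri (1, 0) (0, 0), tri (1, 0) (0, 1),
    tri (1, 0) (1, 1), tri (1, 1) (0, 0), tri (1, 1) (0, 1), tri (1, 1) (1, 0)]

lemma two_mul_sum_le_pairOsc (x : Fin 2 × Fin 2 → ℂ) (m : Fin 2 × Fin 2) :
    2 * ∑ j, ‖x m - x j‖ ≤ pairOsc x := by
  unfold pairOsc
  rw [← Finset.add_sum_erase _ (fun i => ∑ j, ‖x i - x j‖) (Finset.mem_univ m), two_mul]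
  refine add_le_add le_rfl ?_
  calc ∑ j, ‖x m - x j‖ = ∑ j ∈ Finset.univ.erase m, ‖x m - x j‖ := by
        rw [← Finset.add_sum_erase _ (fun j => ‖x m - x j‖) (Finset.mem_univ m)]; simp
    _ ≤ _ := by
        refine Finset.sum_le_sum fun i _ => ?_
        rw [norm_sub_rev]
        exact Finset.single_le_sum (f := fun j => ‖x i - x j‖) (fun _ _ => norm_nonneg _)
          (Finset.mem_univ m)

/-- If sixteen numbers, grouped in four groups of four, are `η`-close to each other with the
exception of one of them, then the oscillation of the four group sums is controlled by that of the
exceptional group. -/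
lemma pairOsc_sum_le {y : Fin 2 × Fin 2 → Fin 2 × Fin 2 → ℂ} {m k₀ : Fin 2 × Fin 2} {η : ℝ}
    (h : ∀ i k i' k', (i, k) ≠ (m, k₀) → (i', k') ≠ (m, k₀) → ‖y i k - y i' k'‖ ≤ η) :
    pairOsc (fun i => ∑ k, y i k) ≤ pairOsc (y m) + 96 * η := by
  obtain ⟨i₀, hi₀⟩ := exists_ne m
  set c := y i₀ k₀
  have hc : ∀ i k, (i, k) ≠ (m, k₀) → ‖y i k - c‖ ≤ η := fun i k hik =>
    h i k i₀ k₀ hik (by simp [hi₀])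
  have hcard : ∀ a : Fin 2 × Fin 2, (Finset.univ.erase a).card = 3 := fun a => by
    rw [Finset.card_erase_of_mem (Finset.mem_univ a)]; rfl
  have sum4 : ∀ i, ‖(∑ k, y i k) - 4 * c‖ ≤ ∑ k, ‖y i k - c‖ := fun i => by
    refine le_trans (le_of_eq ?_) (norm_sum_le _ _)
    rw [Finset.sum_sub_distrib]
    simp
  have other : ∀ i, i ≠ m → ‖(∑ k, y i k) - 4 * c‖ ≤ 4 * η := fun i hi => by
    refine (sum4 i).trans ((Finset.sum_le_card_nsmul _ _ η fun k _ => hc i k (by simp [hi])).trans ?_)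
    simp
  have near : ∑ k ∈ Finset.univ.erase k₀, ‖y m k - c‖ ≤ 3 * η := by
    refine (Finset.sum_le_card_nsmul _ _ η fun k hk => hc m k ?_).trans ?_
    · simpa using Finset.ne_of_mem_erase hk
    · rw [hcard]; simp
  -- The exceptional number is compared with c through each of its three siblings; averaging yields
  -- the coefficient 1/6 that the factor 6 of `pairOsc_le` cancels exactly.
  have far : 3 * ‖y m k₀ - c‖ ≤ pairOsc (y m) / 2 + 3 * η := by
    have e1 : ∑ k ∈ Finset.univ.erase k₀, ‖y m k₀ - c‖ = 3 * ‖y m k₀ - c‖ := by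
      rw [Finset.sum_const, hcard]; simp
    have e2 : ∑ k ∈ Finset.univ.erase k₀, ‖y m k₀ - c‖ ≤
        ∑ k ∈ Finset.univ.erase k₀, ‖y m k₀ - y m k‖ +
          ∑ k ∈ Finset.univ.erase k₀, ‖y m k - c‖ := by
      rw [← Finset.sum_add_distrib]
      exact Finset.sum_le_sum fun k _ => norm_sub_le_norm_sub_add_norm_sub _ _ _
    have e3 : ∑ k ∈ Finset.univ.erase k₀, ‖y m k₀ - y m k‖ ≤ ∑ k, ‖y m k₀ - y m k‖ :=
      Finset.sum_le_sum_of_subset_of_nonneg (Finset.erase_subset _ _) fun _ _ _ => norm_nonneg _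
    have e4 := two_mul_sum_le_pairOsc (y m) k₀
    linarith
  have main : ‖(∑ k, y m k) - 4 * c‖ ≤ pairOsc (y m) / 6 + 4 * η := by
    have := sum4 m
    rw [← Finset.add_sum_erase _ (fun k => ‖y m k - c‖) (Finset.mem_univ k₀)] at this
    linarith
  have all : ∑ i, ‖(∑ k, y i k) - 4 * c‖ ≤ pairOsc (y m) / 6 + 16 * η := by
    rw [← Finset.add_sum_erase _ _ (Finset.mem_univ m)]
    have : ∑ i ∈ Finset.univ.erase m, ‖(∑ k, y i k) - 4 * c‖ ≤ 3 * (4 * η) := by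
      refine (Finset.sum_le_card_nsmul _ _ (4 * η) fun i hi =>
        other i (Finset.ne_of_mem_erase hi)).trans ?_
      rw [hcard]; simp
    linarith
  have := pairOsc_le (fun i => ∑ k, y i k) (4 * c)
  linarith

/-- The variation of `f` inside a child of the dyadic square `(p, q)` of side `2 ^ (h + 1)`. -/
noncomputable def childVar (f : ℕ → ℕ → ℂ) (h p q : ℕ) (i : Fin 2 × Fin 2) : ℝ :=
  cellVar f (2 ^ h) (2 * p + i.1) (2 * q + i.2)

/-- The sum of `f` over a child of the dyadic square `(p, q)` of side `2 ^ (h + 1)`. -/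
noncomputable def childSum (f : ℕ → ℕ → ℂ) (h p q : ℕ) (i : Fin 2 × Fin 2) : ℂ :=
  cellSum f (2 ^ h) (2 * p + i.1) (2 * q + i.2)

/-- Normalized oscillation of the sums of `f` over the four children of the dyadic square `(p, q)`
of side `2 ^ h`; zero if the square is a single pixel. -/
noncomputable def cellOsc (f : ℕ → ℕ → ℂ) : ℕ → ℕ → ℕ → ℝ
  | 0, _, _ => 0
  | h + 1, p, q => pairOsc (childSum f h p q) / (2 * 2 ^ (h + 1))

/-- The variation of `f` inside the dyadic square `(p, q)` of side `2 ^ h` which is not located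
inside the child of largest variation; zero if the square is a single pixel. -/
noncomputable def cellDefect (f : ℕ → ℕ → ℂ) : ℕ → ℕ → ℕ → ℝ
  | 0, _, _ => 0
  | h + 1, p, q => cellVar f (2 ^ (h + 1)) p q - Finset.univ.sup' Finset.univ_nonempty (childVar f h p q)

lemma exists_cellDefect_eq (f : ℕ → ℕ → ℂ) (h p q : ℕ) :
    ∃ m, (∀ i, childVar f h p q i ≤ childVar f h p q m) ∧
      cellDefect f (h + 1) p q = cellVar f (2 ^ (h + 1)) p q - childVar f h p q m := by
  obtain ⟨m, -, hm⟩ := Finset.exists_mem_eq_sup' Finset.univ_nonempty (childVar f h p q)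
  refine ⟨m, fun i => ?_, by rw [cellDefect, hm]⟩
  rw [← hm]
  exact Finset.le_sup' _ (Finset.mem_univ i)

lemma childVar_nonneg (f : ℕ → ℕ → ℂ) (h p q : ℕ) (i : Fin 2 × Fin 2) : 0 ≤ childVar f h p q i :=
  cellVar_nonneg ..

lemma sum_childVar_le (f : ℕ → ℕ → ℂ) (h p q : ℕ) :
    ∑ i, childVar f h p q i ≤ cellVar f (2 ^ (h + 1)) p q := by
  rw [pow_succ']
  exact sum_cellVar_le f (2 ^ h) p q

lemma cellOsc_nonneg (f : ℕ → ℕ → ℂ) (h p q : ℕ) : 0 ≤ cellOsc f h p q := by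
  cases h with
  | zero => exact le_rfl
  | succ h => exact div_nonneg (pairOsc_nonneg _) (by positivity)

lemma cellDefect_nonneg (f : ℕ → ℕ → ℂ) (h p q : ℕ) : 0 ≤ cellDefect f h p q := by
  cases h with
  | zero => exact le_rfl
  | succ h =>
    obtain ⟨m, -, hm⟩ := exists_cellDefect_eq f h p q
    rw [hm]
    have h1 := sum_childVar_le f h p q
    have h2 := Finset.single_le_sum (fun i _ => childVar_nonneg f h p q i) (Finset.mem_univ m)
    linarith

lemma cellVar_one (f : ℕ → ℕ → ℂ) (p q : ℕ) : cellVar f 1 p q = 0 := by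
  simp [cellVar, horizVar, edgeSet]

lemma norm_cellSum_sub_le_two (f : ℕ → ℕ → ℂ) (p q j : ℕ) (hj : j < 2) :
    ‖cellSum f 1 (2 * p + 1) (2 * q + j) - cellSum f 1 (2 * p) (2 * q + j)‖ ≤ cellVar f 2 p q := by
  -- The removed square is a pixel of the other line, chosen to be disjoint from the pair; it
  -- carries no variation.
  have := norm_cellSum_succ_sub_le_of_ne f (L := 1) (m := 2) (p := p) (q := q) (i := 0) (j := j)
    (P := 0) (Q := 1 - j) (by norm_num) hj (by norm_num) (by omega)
    (by rw [ne_eq, Prod.mk.injEq]; omega) (by simp)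
  simpa [cellVar_one] using this

lemma cellOsc_one_le (f : ℕ → ℕ → ℂ) (p q : ℕ) :
    cellOsc f 1 p q ≤ 108 * cellVar f 2 p q := by
  have h := pairOsc_le (childSum f 0 p q) (childSum f 0 p q (0, 0))
  have a1 := norm_cellSum_sub_le_two f p q 0 (by norm_num)
  have a2 := norm_cellSum_sub_le_two f p q 1 (by norm_num)
  have a3 := norm_cellSum_sub_le_two (fun u v => f v u) q p 0 (by norm_num)
  rw [cellSum_swap f, cellSum_swap f, cellVar_swap f] at a3
  have hV := cellVar_nonneg f 2 p q
  simp only [Fintype.sum_prod_type, Fin.sum_univ_two, childSum, pow_zero, Fin.isValue,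
    Fin.val_zero, Fin.val_one, add_zero, sub_self, norm_zero] at h a1 a2 a3
  have tri := norm_sub_le_norm_sub_add_norm_sub (cellSum f 1 (2 * p + 1) (2 * q + 1))
    (cellSum f 1 (2 * p) (2 * q + 1)) (cellSum f 1 (2 * p) (2 * q))
  rw [cellOsc]
  norm_num at h ⊢
  change pairOsc (childSum f 0 p q) ≤ _ at h
  linarith

lemma cellOsc_succ_succ_le (f : ℕ → ℕ → ℂ) (h p q : ℕ) (m k : Fin 2 × Fin 2) :
    cellOsc f (h + 2) p q ≤ cellOsc f (h + 1) (2 * p + m.1) (2 * q + m.2) / 2 +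
      108 * (cellVar f (2 ^ (h + 2)) p q - childVar f h (2 * p + m.1) (2 * q + m.2) k) := by
  set r := cellVar f (2 ^ (h + 2)) p q - childVar f h (2 * p + m.1) (2 * q + m.2) k with hr
  set s : ℕ → ℕ → ℂ := fun i j => cellSum f (2 ^ h) (4 * p + i) (4 * q + j) with hs
  have hm1 := m.1.isLt
  have hm2 := m.2.isLt
  have hk1 := k.1.isLt
  have hk2 := k.2.isLt
  have hr' : r = cellVar f (4 * 2 ^ h) p q -
      cellVar f (2 ^ h) (4 * p + (2 * m.1 + k.1)) (4 * q + (2 * m.2 + k.2)) := by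
    rw [hr, childVar]
    congr 2 <;> ring
  have hr'' : r = cellVar (fun u v => f v u) (4 * 2 ^ h) q p -
      cellVar (fun u v => f v u) (2 ^ h) (4 * q + (2 * m.2 + k.2)) (4 * p + (2 * m.1 + k.1)) := by
    rw [hr', cellVar_swap f, cellVar_swap f]
  have step₁ : ∀ i j, i + 1 < 4 → j < 4 → (i, j) ≠ (2 * (m.1 : ℕ) + k.1, 2 * (m.2 : ℕ) + k.2) →
      (i + 1, j) ≠ (2 * (m.1 : ℕ) + k.1, 2 * (m.2 : ℕ) + k.2) →
      ‖s (i + 1) j - s i j‖ ≤ 2 ^ h * r := by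
    intro i j hi hj h1 h2
    have := norm_cellSum_succ_sub_le_of_ne f (L := 2 ^ h) (p := p) (q := q) hi hj
      (P := 2 * (m.1 : ℕ) + k.1) (Q := 2 * (m.2 : ℕ) + k.2) (by omega) (by omega) h1 h2
    rw [← hr'] at this
    exact_mod_cast this
  have step₂ : ∀ i j, i < 4 → j + 1 < 4 → (i, j) ≠ (2 * (m.1 : ℕ) + k.1, 2 * (m.2 : ℕ) + k.2) →
      (i, j + 1) ≠ (2 * (m.1 : ℕ) + k.1, 2 * (m.2 : ℕ) + k.2) →
      ‖s i (j + 1) - s i j‖ ≤ 2 ^ h * r := by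
    intro i j hi hj h1 h2
    have := norm_cellSum_succ_sub_le_of_ne (fun u v => f v u) (L := 2 ^ h) (p := q) (q := p) hj hi
      (P := 2 * (m.2 : ℕ) + k.2) (Q := 2 * (m.1 : ℕ) + k.1) (by omega) (by omega)
      (by simpa [and_comm] using h1) (by simpa [and_comm] using h2)
    rw [← hr'', cellSum_swap f, cellSum_swap f] at this
    exact_mod_cast this
  have hρ : 0 ≤ 2 ^ h * r := by
    refine mul_nonneg (by positivity) (sub_nonneg.2 ?_)
    have e1 := Finset.single_le_sum (fun i _ => childVar_nonneg f h (2 * p + m.1) (2 * q + m.2) i)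
      (Finset.mem_univ k)
    have e2 := sum_childVar_le f h (2 * p + m.1) (2 * q + m.2)
    have e3 := Finset.single_le_sum (fun i _ => childVar_nonneg f (h + 1) p q i) (Finset.mem_univ m)
    have e4 := sum_childVar_le f (h + 1) p q
    exact e1.trans (e2.trans (e3.trans e4))
  have grid := fun i j i' j' => norm_sub_le_of_punctured_grid (s := s) hρ step₁ step₂
    (i := i) (j := j) (i' := i') (j' := j')
  have osc := pairOsc_sum_le (m := m) (k₀ := k) (η := 9 * (2 ^ h * r))
    (y := fun i k => s (2 * i.1 + k.1) (2 * i.2 + k.2)) (by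
      have key : ∀ i l : Fin 2 × Fin 2, (i, l) ≠ (m, k) →
          (2 * (i.1 : ℕ) + l.1, 2 * (i.2 : ℕ) + l.2) ≠
            (2 * (m.1 : ℕ) + k.1, 2 * (m.2 : ℕ) + k.2) := by
        intro i l hne heq
        rw [Prod.mk.injEq] at heq
        have := i.1.isLt
        have := i.2.isLt
        have := l.1.isLt
        have := l.2.isLt
        have e1 : i = m := Prod.ext (Fin.ext (by omega)) (Fin.ext (by omega))
        have e2 : l = k := Prod.ext (Fin.ext (by omega)) (Fin.ext (by omega))
        exact hne (by rw [e1, e2])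
      intro i l i' l' h1 h2
      have := i.1.isLt
      have := i.2.isLt
      have := l.1.isLt
      have := l.2.isLt
      have := i'.1.isLt
      have := i'.2.isLt
      have := l'.1.isLt
      have := l'.2.isLt
      exact grid _ _ _ _ (by omega) (by omega) (by omega) (by omega) (key i l h1) (key i' l' h2))
  have hy : ∀ i : Fin 2 × Fin 2, (fun l : Fin 2 × Fin 2 => s (2 * i.1 + l.1) (2 * i.2 + l.2)) =
      childSum f h (2 * p + i.1) (2 * q + i.2) := by
    intro i
    funext l
    change cellSum f (2 ^ h) _ _ = cellSum f (2 ^ h) _ _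
    congr 1
    · ring
    · ring
  have hx : (fun i : Fin 2 × Fin 2 => ∑ l : Fin 2 × Fin 2, s (2 * i.1 + l.1) (2 * i.2 + l.2)) =
      childSum f (h + 1) p q := by
    funext i
    rw [childSum, pow_succ', cellSum_two_mul]
    exact Finset.sum_congr rfl fun l _ => congrFun (hy i) l
  rw [hx, hy m] at osc
  rw [cellOsc, cellOsc, div_le_iff₀ (by positivity)]
  calc pairOsc (childSum f (h + 1) p q)
      -- The normalization doubles from one scale to the next, hence the factor 1/2; and 96 · 9 ·
      -- 2^h / (2 · 2^(h+2)) = 108.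
      ≤ pairOsc (childSum f h (2 * p + m.1) (2 * q + m.2)) + 96 * (9 * (2 ^ h * r)) := osc
    _ = _ := by
      field_simp
      ring

/-- The tree potential of the dyadic square `(p, q)` of side `2 ^ h`. -/
noncomputable def cellPotential (f : ℕ → ℕ → ℂ) (h p q : ℕ) : ℝ :=
  treePotential (cellVar f (2 ^ h) p q) (cellOsc f h p q) (cellDefect f h p q)

lemma cellPotential_step (f : ℕ → ℕ → ℂ) (h p q : ℕ) :
    gauge (cellOsc f (h + 1) p q) +
        ∑ i : Fin 2 × Fin 2, cellPotential f h (2 * p + i.1) (2 * q + i.2) ≤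
      cellPotential f (h + 1) p q := by
  obtain ⟨m, hm, hd⟩ := exists_cellDefect_eq f h p q
  refine treePotential_step (v := childVar f h p q)
    (g' := fun i => cellOsc f h (2 * p + i.1) (2 * q + i.2))
    (s' := fun i => cellDefect f h (2 * p + i.1) (2 * q + i.2)) (m := m)
    (childVar_nonneg f h p q) (fun _ => cellOsc_nonneg ..) (fun _ => cellDefect_nonneg ..)
    (cellOsc_nonneg ..) (cellDefect_nonneg ..) hm (sum_childVar_le f h p q) hd ?_
  cases h with
  | zero =>
    have := cellOsc_one_le f p q
    rw [hd]
    simpa [cellOsc, cellDefect, childVar, cellVar_one] using this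
  | succ h =>
    -- For the heaviest child k of m, the variation outside k is the sum of the defects of the
    -- square and of m.
    obtain ⟨k, -, hk⟩ := exists_cellDefect_eq f h (2 * p + m.1) (2 * q + m.2)
    refine (cellOsc_succ_succ_le f h p q m k).trans (le_of_eq ?_)
    rw [hd]
    rw [hk]
    simp only [childVar]
    ring

/-! ### Summation over all scales. -/

lemma sum_range_two_mul {M : Type*} [AddCommMonoid M] (F : ℕ → M) (n : ℕ) :
    ∑ p ∈ Finset.range (2 * n), F p = ∑ p ∈ Finset.range n, ∑ i : Fin 2, F (2 * p + i) := by
  induction n with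
  | zero => simp
  | succ n ih =>
    rw [show 2 * (n + 1) = 2 * n + 1 + 1 by ring, Finset.sum_range_succ, Finset.sum_range_succ, ih,
      Finset.sum_range_succ, Fin.sum_univ_two, add_assoc]
    simp

lemma sum_gauge_cellOsc_le (f : ℕ → ℕ → ℂ) (n : ℕ) :
    ∑ l ∈ Finset.range n, ∑ p ∈ Finset.range (2 ^ l), ∑ q ∈ Finset.range (2 ^ l),
      gauge (cellOsc f (n - l) p q) ≤ 256 * stepConst * cellVar f (2 ^ n) 0 0 := by
  set T : ℕ → ℝ := fun l => ∑ p ∈ Finset.range (2 ^ l), ∑ q ∈ Finset.range (2 ^ l),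
    cellPotential f (n - l) p q with hT
  have hc : 0 ≤ stepConst := by unfold stepConst; norm_num
  have step : ∀ l ∈ Finset.range n, ∑ p ∈ Finset.range (2 ^ l), ∑ q ∈ Finset.range (2 ^ l),
      gauge (cellOsc f (n - l) p q) ≤ T l - T (l + 1) := by
    intro l hl
    rw [Finset.mem_range] at hl
    obtain ⟨h, hh⟩ : ∃ h, n - l = h + 1 := ⟨n - l - 1, by omega⟩
    have hh' : n - (l + 1) = h := by omega
    have split : T (l + 1) = ∑ p ∈ Finset.range (2 ^ l), ∑ q ∈ Finset.range (2 ^ l),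
        ∑ i : Fin 2 × Fin 2, cellPotential f h (2 * p + i.1) (2 * q + i.2) := by
      simp only [hT, hh', pow_succ']
      rw [sum_range_two_mul]
      refine Finset.sum_congr rfl fun p _ => ?_
      simp only [Fintype.sum_prod_type]
      refine Eq.trans (Finset.sum_congr rfl fun i _ => ?_) Finset.sum_comm
      rw [sum_range_two_mul]
    rw [le_sub_iff_add_le, split, ← Finset.sum_add_distrib, hT]
    refine Finset.sum_le_sum fun p _ => ?_
    rw [← Finset.sum_add_distrib]
    refine Finset.sum_le_sum fun q _ => ?_
    rw [hh]
    exact cellPotential_step f h p q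
  refine (Finset.sum_le_sum step).trans ?_
  rw [Finset.sum_range_sub']
  -- At the last level the squares are pixels and all three quantities vanish.
  have hn : 0 ≤ T n := by
    refine Finset.sum_nonneg fun p _ => Finset.sum_nonneg fun q _ => ?_
    simp only [cellPotential, treePotential, Nat.sub_self, cellOsc, cellDefect, pow_zero,
      cellVar_one, gauge_zero, potential_zero]
    simp
  have h0 : T 0 ≤ 256 * stepConst * cellVar f (2 ^ n) 0 0 := by
    simp only [hT, pow_zero, Finset.sum_range_one, Nat.sub_zero, cellPotential, treePotential]
    have e1 := gauge_nonneg (x := cellOsc f n 0 0)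
    have e2 := mul_nonneg hc (gauge_nonneg (x := cellDefect f n 0 0))
    have e3 := mul_le_mul_of_nonneg_left (potential_le (cellVar_nonneg f (2 ^ n) 0 0)) hc
    linarith
  linarith

/-! ### Haar coefficients and total variation of an image -/

/-- Extension of an image by zero to the whole quadrant. -/
noncomputable def extendImage {N : ℕ} (X : Matrix (Fin N) (Fin N) ℂ) (u v : ℕ) : ℂ :=
  if h : u < N ∧ v < N then X ⟨u, h.1⟩ ⟨v, h.2⟩ else 0

@[simp] lemma extendImage_coe {N : ℕ} (X : Matrix (Fin N) (Fin N) ℂ) (a b : Fin N) :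
    extendImage X a b = X a b := by
  simp [extendImage]

lemma sum_fin_ite_mem {N : ℕ} {M : Type*} [AddCommMonoid M] (I : Finset ℕ)
    (hI : I ⊆ Finset.range N) (g : ℕ → M) :
    ∑ a : Fin N, (if (a : ℕ) ∈ I then g a else 0) = ∑ u ∈ I, g u := by
  rw [Fin.sum_univ_eq_sum_range (fun u => if u ∈ I then g u else 0) N, Finset.sum_ite_mem,
    Finset.inter_eq_right.2 hI]

/-- Only edges with both endpoints in the image are counted, so the extension by zero creates no
boundary jump. -/
lemma sum_norm_gradX {N : ℕ} (X : Matrix (Fin N) (Fin N) ℂ) :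
    ∑ a, ∑ b, ‖gradX X a b‖ = horizVar (extendImage X) N 0 0 := by
  unfold horizVar edgeSet
  rw [Finset.sum_product]
  simp only [zero_mul, zero_add, one_mul]
  rw [← sum_fin_ite_mem (N := N) _ (fun u hu => by
    rw [Finset.mem_Ico] at hu; rw [Finset.mem_range]; omega)]
  refine Finset.sum_congr rfl fun a _ => ?_
  by_cases h : (a : ℕ) + 1 < N
  · rw [if_pos (by rw [Finset.mem_Ico]; omega), ← Finset.range_eq_Ico, Finset.sum_range]
    refine Finset.sum_congr rfl fun b _ => ?_
    rw [gradX, dif_pos h, extendImage_coe]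
    congr 2
    exact (extendImage_coe X ⟨a + 1, h⟩ b).symm
  · rw [if_neg (by rw [Finset.mem_Ico]; omega)]
    simp [gradX, h]

lemma gradY_eq_gradX_transpose {N : ℕ} (X : Matrix (Fin N) (Fin N) ℂ) (a b : Fin N) :
    gradY X a b = gradX X.transpose b a := rfl

lemma totalVariation_eq_cellVar {N : ℕ} (X : Matrix (Fin N) (Fin N) ℂ) :
    totalVariation X = cellVar (extendImage X) N 0 0 := by
  have hT : (fun u v => extendImage X v u) = extendImage X.transpose := by
    funext u v
    simp only [extendImage, Matrix.transpose_apply, and_comm]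
  unfold totalVariation cellVar
  simp only [Finset.sum_add_distrib]
  rw [sum_norm_gradX X, hT, ← sum_norm_gradX X.transpose, Finset.sum_comm (f := fun a b => ‖gradY X a b‖)]
  rfl

/-- The sign of a univariate Haar function on the half `i` of its support. -/
def haarSign (e i : Fin 2) : ℝ := if e = 1 ∧ i = 1 then -1 else 1

lemma haarUni_dyadic (e : Fin 2) (j h k a : ℕ) :
    haarUni e (2 ^ j * ((a : ℝ) / ((2 ^ (j + h + 1) : ℕ) : ℝ)) - k) =
      ∑ i : Fin 2, if a ∈ Finset.Ico ((2 * k + i) * 2 ^ h) ((2 * k + i + 1) * 2 ^ h)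
        then haarSign e i else 0 := by
  have hD : (0 : ℝ) < 2 ^ h := by positivity
  have ht : (2 : ℝ) ^ j * ((a : ℝ) / ((2 ^ (j + h + 1) : ℕ) : ℝ)) - k =
      (a - 2 * k * 2 ^ h) / (2 * 2 ^ h) := by
    push_cast
    rw [pow_succ, pow_add]
    field_simp
  set t := (2 : ℝ) ^ j * ((a : ℝ) / ((2 ^ (j + h + 1) : ℕ) : ℝ)) - k
  have e0 : (0 ≤ t) ↔ (2 * k) * 2 ^ h ≤ a := by
    rw [ht, le_div_iff₀ (by positivity), ← Nat.cast_le (α := ℝ)]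
    push_cast
    constructor <;> intro <;> linarith
  have e1 : (t < 1 / 2) ↔ a < (2 * k + 1) * 2 ^ h := by
    rw [ht, div_lt_iff₀ (by positivity), ← Nat.cast_lt (α := ℝ)]
    push_cast
    constructor <;> intro <;> linarith
  have e2 : (t < 1) ↔ a < (2 * k + 1 + 1) * 2 ^ h := by
    rw [ht, div_lt_iff₀ (by positivity), ← Nat.cast_lt (α := ℝ)]
    push_cast
    constructor <;> intro <;> linarith
  have e3 : (1 / 2 ≤ t) ↔ (2 * k + 1) * 2 ^ h ≤ a := by
    rw [← not_lt, e1, not_lt]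
  have p1 : (2 * k + 1) * 2 ^ h = 2 * k * 2 ^ h + 2 ^ h := by ring
  have p2 : (2 * k + 1 + 1) * 2 ^ h = 2 * k * 2 ^ h + 2 ^ h + 2 ^ h := by ring
  have p3 : 0 < 2 ^ h := by positivity
  simp only [Fin.sum_univ_two, Fin.val_zero, Fin.val_one, add_zero, Finset.mem_Ico]
  clear_value t
  obtain rfl | rfl : e = 0 ∨ e = 1 := by fin_cases e <;> simp
  · refine Eq.trans (b := haarZero t) (by simp [haarUni]) ?_
    simp only [haarZero, haarSign, e0, e2]
    rw [p1, p2]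
    generalize 2 * k * 2 ^ h = x
    generalize 2 ^ h = y at p3
    split_ifs <;> first | omega | simp_all
  · refine Eq.trans (b := haarOne t) (by simp [haarUni]) ?_
    simp only [haarOne, haarSign, e0, e1, e2, e3]
    rw [p1, p2]
    generalize 2 * k * 2 ^ h = x
    generalize 2 ^ h = y at p3
    split_ifs <;> first | omega | simp_all

lemma imageInner_toImage {N : ℕ} (X : Matrix (Fin N) (Fin N) ℂ) (F : ℝ × ℝ → ℝ) :
    imageInner X (toImage N F) =
      ∑ a, ∑ b, X a b * ((F ((a : ℝ) / N, (b : ℝ) / N) / N : ℝ) : ℂ) := by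
  simp only [imageInner, Matrix.trace, Matrix.diag, Matrix.mul_apply, Matrix.conjTranspose_apply,
    toImage, RCLike.star_def, Complex.conj_ofReal]

lemma dyadic_Ico_subset_range {j h k i : ℕ} (hk : k < 2 ^ j) (hi : i < 2) :
    Finset.Ico ((2 * k + i) * 2 ^ h) ((2 * k + i + 1) * 2 ^ h) ⊆
      Finset.range (2 ^ (j + h + 1)) := by
  intro u hu
  rw [Finset.mem_Ico] at hu
  rw [Finset.mem_range]
  refine hu.2.trans_le ?_
  rw [show 2 ^ (j + h + 1) = (2 * 2 ^ j) * 2 ^ h by ring]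
  exact Nat.mul_le_mul_right _ (by omega)

/-- The wavelet is constant on each child, and 2^j / N = 1 / 2^(h+1). -/
lemma imageInner_haarFun {j h : ℕ} (X : Matrix (Fin (2 ^ (j + h + 1))) (Fin (2 ^ (j + h + 1))) ℂ)
    {k l : ℕ} (hk : k < 2 ^ j) (hl : l < 2 ^ j) (e : Fin 2 × Fin 2) :
    imageInner X (toImage (2 ^ (j + h + 1)) (haarFun j (k, l) e)) =
      (∑ i : Fin 2 × Fin 2, ((haarSign e.1 i.1 * haarSign e.2 i.2 : ℝ) : ℂ) *
        childSum (extendImage X) h k l i) / 2 ^ (h + 1) := by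
  rw [imageInner_toImage]
  have main : ∀ a b : Fin (2 ^ (j + h + 1)),
      X a b * ((haarFun j (k, l) e ((a : ℝ) / ((2 ^ (j + h + 1) : ℕ) : ℝ),
        (b : ℝ) / ((2 ^ (j + h + 1) : ℕ) : ℝ)) / ((2 ^ (j + h + 1) : ℕ) : ℝ) : ℝ) : ℂ) =
      ∑ i : Fin 2 × Fin 2,
        (if (a : ℕ) ∈ Finset.Ico ((2 * k + i.1) * 2 ^ h) ((2 * k + i.1 + 1) * 2 ^ h) then
          (if (b : ℕ) ∈ Finset.Ico ((2 * l + i.2) * 2 ^ h) ((2 * l + i.2 + 1) * 2 ^ h) then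
            ((haarSign e.1 i.1 * haarSign e.2 i.2 : ℝ) : ℂ) * extendImage X a b / 2 ^ (h + 1)
            else 0) else 0) := by
    intro a b
    simp only [haarFun, haarTensor]
    rw [haarUni_dyadic e.1 j h k a, haarUni_dyadic e.2 j h l b, Finset.sum_mul_sum,
      Fintype.sum_prod_type, mul_div_right_comm, Finset.mul_sum, Complex.ofReal_sum,
      Finset.mul_sum]
    refine Finset.sum_congr rfl fun i _ => ?_
    rw [Finset.mul_sum, Complex.ofReal_sum, Finset.mul_sum]
    refine Finset.sum_congr rfl fun i' _ => ?_
    rw [extendImage_coe]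
    split_ifs
    · push_cast
      rw [pow_succ (2 : ℂ) (j + h), pow_add, pow_succ]
      field_simp
    · simp
    · simp
    · simp
  rw [Finset.sum_congr rfl fun a _ => Finset.sum_congr rfl fun b _ => main a b]
  rw [Finset.sum_congr rfl fun a _ => Finset.sum_comm, Finset.sum_comm, Finset.sum_div]
  refine Finset.sum_congr rfl fun i _ => ?_
  have collapse : ∀ a : Fin (2 ^ (j + h + 1)), ∀ p : Prop, [Decidable p] →
      ∑ b : Fin (2 ^ (j + h + 1)), (if p then
        (if (b : ℕ) ∈ Finset.Ico ((2 * l + i.2) * 2 ^ h) ((2 * l + i.2 + 1) * 2 ^ h) then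
          ((haarSign e.1 i.1 * haarSign e.2 i.2 : ℝ) : ℂ) * extendImage X a b / 2 ^ (h + 1)
          else 0) else 0) =
      if p then ∑ v ∈ Finset.Ico ((2 * l + i.2) * 2 ^ h) ((2 * l + i.2 + 1) * 2 ^ h),
        ((haarSign e.1 i.1 * haarSign e.2 i.2 : ℝ) : ℂ) * extendImage X a v / 2 ^ (h + 1)
      else 0 := by
    intro a p _
    split_ifs
    · exact sum_fin_ite_mem _ (dyadic_Ico_subset_range hl i.2.isLt)
        (fun v => ((haarSign e.1 i.1 * haarSign e.2 i.2 : ℝ) : ℂ) * extendImage X a v / 2 ^ (h + 1))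
    · simp
  rw [Finset.sum_congr rfl fun a _ => collapse a _,
    sum_fin_ite_mem _ (dyadic_Ico_subset_range hk i.1.isLt) (fun u =>
      ∑ v ∈ Finset.Ico ((2 * l + i.2) * 2 ^ h) ((2 * l + i.2 + 1) * 2 ^ h),
        ((haarSign e.1 i.1 * haarSign e.2 i.2 : ℝ) : ℂ) * extendImage X u v / 2 ^ (h + 1))]
  simp only [childSum, cellSum, Finset.mul_sum, Finset.sum_div]

/-- A nontrivial sign pattern has two plus and two minus signs, so the signed sum splits into two
differences over distinct unordered pairs. -/
lemma norm_sum_haarSign_le (x : Fin 2 × Fin 2 → ℂ) {e : Fin 2 × Fin 2} (he : e ≠ (0, 0)) :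
    ‖∑ i : Fin 2 × Fin 2, ((haarSign e.1 i.1 * haarSign e.2 i.2 : ℝ) : ℂ) * x i‖ ≤
      pairOsc x / 2 := by
  have h1 := fun i j => norm_nonneg (x i - x j)
  have h2 := fun i j => norm_sub_rev (x i) (x j)
  have tri := fun a b c d => norm_add_le (x a - x b) (x c - x d)
  obtain ⟨e₁, e₂⟩ := e
  simp only [pairOsc, Fintype.sum_prod_type, Fin.sum_univ_two, sub_self, norm_zero]
  have pos := add_nonneg (add_nonneg (add_nonneg (h1 (0, 0) (0, 1)) (h1 (0, 0) (1, 0)))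
    (add_nonneg (h1 (0, 0) (1, 1)) (h1 (0, 1) (1, 0)))) (add_nonneg (h1 (0, 1) (1, 1))
    (h1 (1, 0) (1, 1)))
  rw [h2 (0, 1) (0, 0), h2 (1, 0) (0, 0), h2 (1, 1) (0, 0), h2 (1, 0) (0, 1), h2 (1, 1) (0, 1),
    h2 (1, 1) (1, 0)]
  have fin : ∀ a b c d : Fin 2 × Fin 2, ∀ z : ℂ, z = (x a - x b) + (x c - x d) →
      ‖x a - x b‖ + ‖x c - x d‖ ≤ ‖x (0, 0) - x (0, 1)‖ + ‖x (0, 0) - x (1, 0)‖ +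
        (‖x (0, 0) - x (1, 1)‖ + ‖x (0, 1) - x (1, 0)‖) +
        (‖x (0, 1) - x (1, 1)‖ + ‖x (1, 0) - x (1, 1)‖) →
      ‖z‖ ≤ ‖x (0, 0) - x (0, 1)‖ + ‖x (0, 0) - x (1, 0)‖ +
        (‖x (0, 0) - x (1, 1)‖ + ‖x (0, 1) - x (1, 0)‖) +
        (‖x (0, 1) - x (1, 1)‖ + ‖x (1, 0) - x (1, 1)‖) := by
    rintro a b c d z rfl hle
    exact (tri a b c d).trans hle
  refine (?_ : _ ≤ _).trans (le_of_eq (?_ : ‖x (0, 0) - x (0, 1)‖ + ‖x (0, 0) - x (1, 0)‖ +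
        (‖x (0, 0) - x (1, 1)‖ + ‖x (0, 1) - x (1, 0)‖) +
        (‖x (0, 1) - x (1, 1)‖ + ‖x (1, 0) - x (1, 1)‖) = _))
  · fin_cases e₁ <;> fin_cases e₂
    · exact absurd rfl he
    · refine fin (0, 0) (0, 1) (1, 0) (1, 1) _ ?_ ?_
      · simp [haarSign]; ring
      · linarith [h1 (0, 0) (1, 0), h1 (0, 0) (1, 1), h1 (0, 1) (1, 0), h1 (0, 1) (1, 1)]
    · refine fin (0, 0) (1, 0) (0, 1) (1, 1) _ ?_ ?_
      · simp [haarSign]; ring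
      · linarith [h1 (0, 0) (0, 1), h1 (0, 0) (1, 1), h1 (0, 1) (1, 0), h1 (1, 0) (1, 1)]
    · refine fin (0, 0) (0, 1) (1, 1) (1, 0) _ ?_ ?_
      · simp [haarSign]; ring
      · rw [h2 (1, 1) (1, 0)]
        linarith [h1 (0, 0) (1, 0), h1 (0, 0) (1, 1), h1 (0, 1) (1, 0), h1 (0, 1) (1, 1)]
  · ring

lemma norm_haarCoeff_le {n : ℕ} (X : Matrix (Fin (2 ^ n)) (Fin (2 ^ n)) ℂ) (i : HaarIndex n) :
    ‖haarCoeff X i‖ ≤ cellOsc (extendImage X) (n - (i.1 : ℕ)) i.2.1.1 i.2.1.2 := by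
  obtain ⟨⟨j, hj⟩, ⟨⟨k, hk⟩, ⟨l, hl⟩⟩, ⟨e, he⟩⟩ := i
  obtain ⟨h, rfl⟩ : ∃ h, n = j + h + 1 := ⟨n - j - 1, by omega⟩
  have hn : j + h + 1 - j = h + 1 := by omega
  dsimp only [haarCoeff, haarImage, haarWavelet]
  dsimp only at hk hl
  rw [imageInner_haarFun X hk hl e, hn, cellOsc, norm_div, div_mul_eq_div_div]
  have := norm_sum_haarSign_le (childSum (extendImage X) h k l) he
  simp only [norm_pow, Complex.norm_ofNat]
  gcongr

lemma sum_gauge_haarCoeff_le {n : ℕ} (X : Matrix (Fin (2 ^ n)) (Fin (2 ^ n)) ℂ) :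
    ∑ i : HaarIndex n, gauge ‖haarCoeff X i‖ ≤ 768 * stepConst * totalVariation X := by
  have hcard : Fintype.card {e : Fin 2 × Fin 2 // e ≠ (0, 0)} = 3 := by decide
  calc ∑ i : HaarIndex n, gauge ‖haarCoeff X i‖
      ≤ ∑ i : HaarIndex n, gauge (cellOsc (extendImage X) (n - (i.1 : ℕ)) i.2.1.1 i.2.1.2) :=
        Finset.sum_le_sum fun i _ => gauge_mono (norm_nonneg _) (norm_haarCoeff_le X i)
    _ = 3 * ∑ l ∈ Finset.range n, ∑ p ∈ Finset.range (2 ^ l), ∑ q ∈ Finset.range (2 ^ l),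
          gauge (cellOsc (extendImage X) (n - l) p q) := by
        rw [Fintype.sum_sigma, Finset.sum_range, Finset.mul_sum]
        refine Finset.sum_congr rfl fun j _ => ?_
        rw [Fintype.sum_prod_type]
        dsimp only
        simp only [Finset.sum_const, Finset.card_univ, hcard, nsmul_eq_mul, ← Finset.mul_sum]
        rw [Fintype.sum_prod_type, Finset.sum_range]
        simp only [Finset.sum_range]
        norm_num
    _ ≤ 3 * (256 * stepConst * cellVar (extendImage X) (2 ^ n) 0 0) :=
        mul_le_mul_of_nonneg_left (sum_gauge_cellOsc_le (extendImage X) n) (by norm_num)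
    _ = _ := by rw [totalVariation_eq_cellVar]; ring

/-! ### The weak type estimate -/

lemma gradX_smul {N : ℕ} (c : ℂ) (X : Matrix (Fin N) (Fin N) ℂ) (a b : Fin N) :
    gradX (c • X) a b = c * gradX X a b := by
  simp only [gradX, Matrix.smul_apply, smul_eq_mul]
  split_ifs <;> ring

lemma totalVariation_smul {N : ℕ} (c : ℂ) (X : Matrix (Fin N) (Fin N) ℂ) :
    totalVariation (c • X) = ‖c‖ * totalVariation X := by
  simp only [totalVariation, gradY_eq_gradX_transpose, Matrix.transpose_smul, gradX_smul, norm_mul,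
    Finset.mul_sum, mul_add]

lemma haarCoeff_smul {n : ℕ} (c : ℂ) (X : Matrix (Fin (2 ^ n)) (Fin (2 ^ n)) ℂ)
    (i : HaarIndex n) : haarCoeff (c • X) i = c * haarCoeff X i := by
  simp [haarCoeff, imageInner, Matrix.trace_smul]

lemma totalVariation_nonneg {N : ℕ} (X : Matrix (Fin N) (Fin N) ℂ) : 0 ≤ totalVariation X := by
  unfold totalVariation; positivity

lemma gauge_one_pos : 0 < gauge 1 := by
  unfold gauge; positivity

/-- The constant in the weak type estimate. -/
noncomputable def weakConst : ℝ := 768 * stepConst / gauge 1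

lemma weakConst_pos : 0 < weakConst :=
  div_pos (by unfold stepConst; norm_num) gauge_one_pos

/-- Chebyshev's inequality for the gauge after rescaling: coefficients and variation are homogeneous
of degree one, the gauge is not. -/
lemma card_haarCoeff_ge_mul_le {n : ℕ} (X : Matrix (Fin (2 ^ n)) (Fin (2 ^ n)) ℂ) {t : ℝ}
    (ht : 0 < t) :
    ((Finset.univ.filter fun i => t ≤ ‖haarCoeff X i‖).card : ℝ) * t ≤
      weakConst * totalVariation X := by
  set S := Finset.univ.filter fun i => t ≤ ‖haarCoeff X i‖
  set Y := ((t⁻¹ : ℝ) : ℂ) • X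
  have hnorm : ‖((t⁻¹ : ℝ) : ℂ)‖ = t⁻¹ := by
    rw [Complex.norm_real, Real.norm_of_nonneg (by positivity)]
  have h1 : (S.card : ℝ) * gauge 1 ≤ ∑ i, gauge ‖haarCoeff Y i‖ := by
    calc (S.card : ℝ) * gauge 1 = ∑ i ∈ S, gauge 1 := by rw [Finset.sum_const, nsmul_eq_mul]
      _ ≤ ∑ i ∈ S, gauge ‖haarCoeff Y i‖ := by
        refine Finset.sum_le_sum fun i hi => gauge_mono zero_le_one ?_
        have hti : t ≤ ‖haarCoeff X i‖ := (Finset.mem_filter.1 hi).2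
        rw [haarCoeff_smul, norm_mul, hnorm, inv_mul_eq_div, le_div_iff₀ ht]
        linarith
      _ ≤ _ := Finset.sum_le_sum_of_subset_of_nonneg (Finset.subset_univ _)
        fun _ _ _ => gauge_nonneg
  have h2 := h1.trans (sum_gauge_haarCoeff_le Y)
  rw [totalVariation_smul, hnorm] at h2
  rw [weakConst, div_mul_eq_mul_div, le_div_iff₀ gauge_one_pos]
  calc (S.card : ℝ) * t * gauge 1 = S.card * gauge 1 * t := by ring
    _ ≤ 768 * stepConst * (t⁻¹ * totalVariation X) * t := by gcongr
    _ = 768 * stepConst * totalVariation X := by field_simp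

/-- Positivity rules out the default value 0, so the sorted list really has k entries, the first k
being at least the k-th. -/
lemma le_card_of_kthLargest_pos {ι : Type*} [Fintype ι] (c : ι → ℂ) {k : ℕ} (hk : 1 ≤ k)
    (hpos : 0 < kthLargest c k) :
    k ≤ (Finset.univ.filter fun i => kthLargest c k ≤ ‖c i‖).card := by
  set t := kthLargest c k with ht
  unfold kthLargest at ht
  set s := (Finset.univ : Finset ι).val.map fun i => ‖c i‖ with hs
  set l := s.sort (· ≥ ·) with hl
  have hlen : k - 1 < l.length := by
    by_contra hcon
    rw [List.getD_eq_default _ _ (by omega)] at ht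
    exact hpos.ne' ht
  rw [List.getD_eq_getElem _ _ hlen] at ht
  have hsorted : l.Pairwise (· ≥ ·) := s.pairwise_sort (· ≥ ·)
  have htake : ∀ x ∈ l.take k, t ≤ x := by
    intro x hx
    obtain ⟨m, hm, rfl⟩ := List.mem_iff_getElem.1 hx
    rw [List.length_take] at hm
    rw [List.getElem_take, ht]
    rcases (show m ≤ k - 1 by omega).eq_or_lt with h | h
    · subst h; exact le_rfl
    · exact List.pairwise_iff_getElem.1 hsorted _ _ _ _ h
  have hcount : k ≤ l.countP (fun x => decide (t ≤ x)) := by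
    have h1 : (l.take k).countP (fun x => decide (t ≤ x)) = (l.take k).length :=
      List.countP_eq_length.2 fun x hx => by simpa using htake x hx
    have h2 := (List.take_sublist k l).countP_le (p := fun x => decide (t ≤ x))
    rw [h1, List.length_take] at h2
    omega
  refine hcount.trans (le_of_eq ?_)
  have h3 : ((l : Multiset ℝ)).countP (fun x => t ≤ x) = l.countP (fun x => decide (t ≤ x)) :=
    Multiset.coe_countP _ _
  rw [← h3, hl, Multiset.sort_eq, hs, Multiset.countP_map]
  rfl

lemma kthLargest_haarCoeff_le {n : ℕ} (X : Matrix (Fin (2 ^ n)) (Fin (2 ^ n)) ℂ) {k : ℕ}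
    (hk : 1 ≤ k) : kthLargest (haarCoeff X) k ≤ weakConst * totalVariation X / k := by
  have hk' : (0 : ℝ) < k := by exact_mod_cast hk
  have hC := weakConst_pos
  have hV := totalVariation_nonneg X
  rcases le_or_gt (kthLargest (haarCoeff X) k) 0 with h | h
  · exact h.trans (by positivity)
  · have h1 : (k : ℝ) ≤ _ := Nat.cast_le.2 (le_card_of_kthLargest_pos _ hk h)
    rw [le_div_iff₀ hk', mul_comm]
    exact (mul_le_mul_of_nonneg_right h1 h.le).trans (card_haarCoeff_ge_mul_le X h)

lemma card_fullHaarCoeff_ge {n : ℕ} (X : Matrix (Fin (2 ^ n)) (Fin (2 ^ n)) ℂ) (t : ℝ) :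
    (Finset.univ.filter fun i => t ≤ ‖fullHaarCoeff X i‖).card =
      (if t ≤ ‖imageInner X (constImage n)‖ then 1 else 0) +
        (Finset.univ.filter fun i => t ≤ ‖haarCoeff X i‖).card := by
  rw [Finset.card_filter, Finset.card_filter, Fintype.sum_option]
  rfl

lemma imageInner_constImage {n : ℕ} (X : Matrix (Fin (2 ^ n)) (Fin (2 ^ n)) ℂ) :
    imageInner X (constImage n) = (∑ a, ∑ b, X a b) / 2 ^ n := by
  rw [constImage, imageInner_toImage, Finset.sum_div]
  refine Finset.sum_congr rfl fun a _ => ?_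
  rw [Finset.sum_div]
  refine Finset.sum_congr rfl fun b _ => ?_
  have hz : ∀ a : Fin (2 ^ n), haarZero ((a : ℝ) / ((2 ^ n : ℕ) : ℝ)) = 1 := fun a => by
    have h1 : ((a : ℕ) : ℝ) < ((2 ^ n : ℕ) : ℝ) := Nat.cast_lt.2 a.isLt
    exact if_pos ⟨by positivity, by rwa [div_lt_one (by positivity)]⟩
  simp only [haarTensor, haarUni, if_true, hz]
  push_cast
  ring

end HaarTV

/-! ### Conclusion, with and without the constant image. -/

theorem mainTheorem4 :
    ∃ C : ℝ, 0 < C ∧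
      ∀ (n : ℕ) (X : Matrix (Fin (2 ^ n)) (Fin (2 ^ n)) ℂ) (k : ℕ), 1 ≤ k →
        HaarTV.kthLargest (HaarTV.haarCoeff X) k ≤ C * HaarTV.totalVariation X / k ∧
        ((2 ≤ k ∨ ∑ a, ∑ b, X a b = 0) →
          HaarTV.kthLargest (HaarTV.fullHaarCoeff X) k ≤ C * HaarTV.totalVariation X / k) := by
  have hC := HaarTV.weakConst_pos
  refine ⟨2 * HaarTV.weakConst, by positivity, fun n X k hk => ?_⟩
  have hk' : (0 : ℝ) < k := by exact_mod_cast hk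
  have hV := HaarTV.totalVariation_nonneg X
  refine ⟨(HaarTV.kthLargest_haarCoeff_le X hk).trans ?_, fun hor => ?_⟩
  · gcongr
    linarith
  set t := HaarTV.kthLargest (HaarTV.fullHaarCoeff X) k with ht
  rcases le_or_gt t 0 with h | h
  · exact h.trans (by positivity)
  have hcard := HaarTV.le_card_of_kthLargest_pos _ hk h
  rw [← ht, HaarTV.card_fullHaarCoeff_ge] at hcard
  have hweak := HaarTV.card_haarCoeff_ge_mul_le X h
  set m := (Finset.univ.filter fun i => t ≤ ‖HaarTV.haarCoeff X i‖).card
  -- The constant image adds at most one large coefficient: k ≤ m + 1 and k ≥ 2 give k ≤ 2m, whence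
  -- the doubled constant. For mean zero its coefficient is 0 < t and is not counted.
  have hkm : k ≤ 2 * m := by
    rcases hor with h2 | h0
    · split_ifs at hcard <;> omega
    · rw [HaarTV.imageInner_constImage, h0, zero_div, norm_zero, if_neg (not_le.2 h)] at hcard
      omega
  have hkm' : (k : ℝ) ≤ 2 * m := by exact_mod_cast hkm
  rw [le_div_iff₀ hk']
  nlinarith
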